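/- Let $\nu>-1$ and let $J_\nu(x)=\sum_{n\ge 0}\frac{(-1)^n (x/2)^{2n+\nu}}{n!\,\Gamma(n+\nu+1)}$ $(x>0)$ be the Bessel function of the first kind of order $\nu$. Put $$d_\nu(x)=(1-\nu)J_\nu(x)+xJ_\nu'(x),\qquad g_\nu(x)=2^\nu\Gamma(\nu+1)x^{1-\nu}J_\nu(x)\qquad(x>0),$$ let $\alpha_{\nu,0}=0$, let $\alpha_{\nu,n}$ $(n\ge1)$ be the $n$th positive zero of the Dini function $d_\nu$, and let $\Delta_\nu=\bigcup_{k\ge0}(\alpha_{\nu,2k},\alpha_{\nu,2k+1})$. Then $g_\nu$ is differentiable on $(0,\infty)$ with $g_\nu'(x)=2^\nu\Gamma(\nu+1)x^{-\nu}d_\nu(x)$, and $g_\nu'$ is positive and log-concave on each of the intervals $(\alpha_{\nu,2k},\alpha_{\nu,2k+1})$ that make up $\Delta_\nu$. Consequently, for all $a,b$ lying in the same interval $(\alpha_{\nu,2k},\alpha_{\nu,2k+1})$ of $\Delta_\nu$, $k\ge0$, $$|g_\nu(a)-g_\nu(b)|\ \ge\ |a-b|\sqrt{g_\nu'(a)\,g_\nu'(b)},$$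 or equivalently $$\left|a^{1-\nu}J_\nu(a)-b^{1-\nu}J_\nu(b)\right|\ \ge\ |a-b|\sqrt{(ab)^{-\nu}d_\nu(a)d_\nu(b)}.$$ -/

import Mathlib

noncomputable section

/-- The Bessel function of the first kind `J_ν`, real order, on the positive half-line:
`J_ν(x) = ∑_{n ≥ 0} (-1)^n (x/2)^(2n+ν) / (n! Γ(n+ν+1))`. -/
def besselJ (ν x : ℝ) : ℝ :=
  ∑' n : ℕ, (-1 : ℝ) ^ n * (x / 2) ^ (2 * (n : ℝ) + ν) /
    ((n.factorial : ℝ) * Real.Gamma ((n : ℝ) + ν + 1))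

/-- The Dini function `d_ν(x) = (1 - ν) J_ν(x) + x J_ν'(x)`. -/
def dini (ν x : ℝ) : ℝ :=
  (1 - ν) * besselJ ν x + x * deriv (besselJ ν) x

/-- The normalized Bessel function `g_ν(x) = 2^ν Γ(ν+1) x^(1-ν) J_ν(x)`. -/
def normBessel (ν x : ℝ) : ℝ :=
  (2 : ℝ) ^ ν * Real.Gamma (ν + 1) * x ^ (1 - ν) * besselJ ν x

/-- `diniZero ν 0 = 0`, and for `n ≥ 1`, `diniZero ν n` is the `n`-th positive zero of `d_ν`:
the first zero to the right of the previous one. -/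
def diniZero (ν : ℝ) : ℕ → ℝ
  | 0 => 0
  | n + 1 => sInf {x : ℝ | diniZero ν n < x ∧ dini ν x = 0}

/-- The `k`-th interval `(α_{ν,2k}, α_{ν,2k+1})` of the open set `Δ_ν`, which is the union of
these pairwise disjoint intervals over `k ≥ 0`. -/
def deltaInterval (ν : ℝ) (k : ℕ) : Set ℝ :=
  Set.Ioo (diniZero ν (2 * k)) (diniZero ν (2 * k + 1))

/-- A function is log-concave on an interval (a convex set) if it is positive there and its
logarithm is concave there. -/
def LogConcaveOn (s : Set ℝ) (f : ℝ → ℝ) : Prop :=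
  (∀ x ∈ s, 0 < f x) ∧ ConcaveOn ℝ s (fun x => Real.log (f x))

end

/-! Put j(x) = 2^ν Γ(ν+1) x^(-ν) J_ν(x), an even entire function, and D = (x j)' = g_ν'. Where D >
0, log-concavity of D is the Laguerre inequality D D'' ≤ D'^2 (`besselSeries_laguerre`). It holds
for real-rooted polynomials and survives pointwise limits of the function and its derivatives, so no
product over the zeros of D is needed. The approximants are (x L_n(x²))', rescaled, with L_n the
Laguerre polynomials: L_n(x²) is real-rooted by induction on n (`splits_laguerre_step`), and Rolle's
theorem handles the derivative.

For the sign, D(0) = 1 and D changes sign at every positive zero, because these zeros are simple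
(`deriv_diniEntire_ne_zero`, from ∫ t J_ν(t)² dt > 0). Sturm comparison and Rolle give arbitrarily
large zeros, so every α_{ν,n} with n ≥ 1 is a genuine zero and D > 0 on Δ_ν.

Finally, if h = f' is log-concave and m is the midpoint of [a, b], then h(m+t) h(m-t) ≥ h(a) h(b);
the AM-GM inequality and integration in t give the bound (`mul_sqrt_le_sub_of_logConcave`). -/

open Filter Topology

/-! ### Real-rooted polynomials -/

open Polynomial in
/-- The Laguerre inequality for polynomials all of whose roots are real. -/
theorem laguerre_inequality {p : ℝ[X]} (hp : p.Splits) (x : ℝ) :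
    p.eval x * p.derivative.derivative.eval x ≤ p.derivative.eval x ^ 2 := by
  induction hp using Submonoid.closure_induction with
  | mem p hp =>
    rcases hp with ⟨a, rfl⟩ | ⟨a, rfl⟩ <;> simp
  | one => simp
  | mul p q _ _ hp hq =>
    -- The defect Q(p) = p'^2 - p p'' satisfies Q(pq) = q² Q(p) + p² Q(q).
    simp only [derivative_mul, derivative_add, eval_add, eval_mul]
    nlinarith [mul_le_mul_of_nonneg_left hp (sq_nonneg (q.eval x)),
      mul_le_mul_of_nonneg_left hq (sq_nonneg (p.eval x))]

-- Rolle: differentiation loses at most one root, and it lowers the degree by at least one when the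
-- degree is positive.
open Polynomial in
theorem splits_derivative_of_splits {p : ℝ[X]} (hp : p.Splits) : p.derivative.Splits := by
  have h1 := card_roots_le_derivative p
  have h2 := splits_iff_card_roots.1 hp
  have h3 := card_roots' p.derivative
  have h4 := natDegree_derivative_le p
  rw [splits_iff_card_roots]
  omega

open Polynomial in
/-- A polynomial over `ℝ` splits if all of its complex roots are real. -/
theorem splits_of_complex_roots_real {p : ℝ[X]}
    (h : ∀ z : ℂ, (p.map (algebraMap ℝ ℂ)).eval z = 0 → z.im = 0) : p.Splits := by
  by_cases hp : p = 0
  · simp [hp]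
  refine Splits.of_splits_map_of_injective (i := algebraMap ℝ ℂ)
    (algebraMap ℝ ℂ).injective (IsAlgClosed.splits _) ?_
  intro z hz
  refine ⟨z.re, ?_⟩
  have := h z (isRoot_of_mem_roots hz)
  apply Complex.ext <;> simp [this]

open Polynomial in
/-- The logarithmic derivative of a real-rooted polynomial maps the upper half plane to the closed
lower half plane and vice versa. -/
theorem im_mul_im_logDeriv_nonpos {p : ℝ[X]} (hp : p.Splits) {z : ℂ}
    (hz : (p.map (algebraMap ℝ ℂ)).eval z ≠ 0) :
    z.im * ((p.map (algebraMap ℝ ℂ)).derivative.eval z /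
      (p.map (algebraMap ℝ ℂ)).eval z).im ≤ 0 := by
  rw [(hp.map _).eval_derivative_div_eval_of_ne_zero hz,
    hp.roots_map_of_injective (algebraMap ℝ ℂ).injective, Multiset.map_map]
  induction p.roots using Multiset.induction with
  | empty => simp
  | cons a s ih =>
    simp only [Multiset.map_cons, Multiset.sum_cons, Complex.add_im, mul_add]
    refine add_nonpos ?_ ih
    simp only [Function.comp, one_div, Complex.inv_im, Complex.coe_algebraMap, Complex.sub_im,
      Complex.ofReal_im, sub_zero]
    rw [mul_div_assoc', mul_neg, neg_div]
    exact neg_nonpos.2 (div_nonneg (mul_self_nonneg _) (Complex.normSq_nonneg _))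

open Polynomial in
/-- The operator `p ↦ x p' + (c - 2 x²) p` with `c > 0` preserves real-rootedness. -/
theorem splits_laguerre_step {p : ℝ[X]} (hp : p.Splits) {c : ℝ} (hc : 0 < c) :
    (X * derivative p + (C c - C 2 * X ^ 2) * p).Splits := by
  by_cases hp0 : p = 0
  · simp [hp0]
  refine splits_of_complex_roots_real fun z hz => ?_
  set P := p.map (algebraMap ℝ ℂ) with hP
  by_cases hz0 : P.eval z = 0
  · have hmem : z ∈ P.roots := by
      rw [mem_roots (by simpa [hP, Polynomial.map_eq_zero] using hp0)]; exact hz0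
    rw [hp.roots_map_of_injective (algebraMap ℝ ℂ).injective] at hmem
    obtain ⟨r, -, rfl⟩ := Multiset.mem_map.1 hmem
    simp
  by_contra him
  have hzne : z ≠ 0 := by rintro rfl; simp at him
  have hlog := im_mul_im_logDeriv_nonpos hp hz0
  -- At a nonreal zero z of the image, P'/P = 2z - c/z has imaginary part of the same sign as Im z,
  -- contrary to `hlog`.
  have hkey : P.derivative.eval z / P.eval z = 2 * z - c / z := by
    simp only [Polynomial.map_add, Polynomial.map_mul, Polynomial.map_sub, map_X, map_C,
      Polynomial.map_pow, ← derivative_map, ← hP, eval_add, eval_mul, eval_X, eval_sub, eval_C,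
      eval_pow, Complex.coe_algebraMap] at hz
    push_cast at hz
    field_simp
    linear_combination hz
  rw [← hP, hkey] at hlog
  have hn := Complex.normSq_pos.2 hzne
  have hsq : 0 < z.im ^ 2 := by positivity
  have : z.im * (2 * z - c / z).im = 2 * z.im ^ 2 + c * (z.im ^ 2 / Complex.normSq z) := by
    simp [Complex.div_im]
    field_simp
  rw [this] at hlog
  have : 0 < c * (z.im ^ 2 / Complex.normSq z) := by positivity
  linarith

/-! ### Power series with Bessel coefficients -/

/-- The Taylor coefficients of `2^ν Γ(ν+1) x^(-ν) J_ν(x)` in the variable `x²`. -/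
noncomputable def besselCoeff (ν : ℝ) (k : ℕ) : ℝ :=
  (-1) ^ k * Real.Gamma (ν + 1) / (4 ^ k * (k.factorial : ℝ) * Real.Gamma ((k : ℝ) + ν + 1))

theorem besselCoeff_zero {ν : ℝ} (hν : -1 < ν) : besselCoeff ν 0 = 1 := by
  have : Real.Gamma (ν + 1) ≠ 0 := (Real.Gamma_pos_of_pos (by linarith)).ne'
  simp [besselCoeff, this]

theorem besselCoeff_ne_zero {ν : ℝ} (hν : -1 < ν) (k : ℕ) : besselCoeff ν k ≠ 0 := by
  have h0 : Real.Gamma (ν + 1) ≠ 0 := (Real.Gamma_pos_of_pos (by linarith)).ne'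
  have h1 : Real.Gamma ((k : ℝ) + ν + 1) ≠ 0 :=
    (Real.Gamma_pos_of_pos (by have := k.cast_nonneg (α := ℝ); linarith)).ne'
  unfold besselCoeff
  positivity

theorem besselCoeff_succ {ν : ℝ} (hν : -1 < ν) (k : ℕ) :
    4 * ((k : ℝ) + 1) * ((k : ℝ) + 1 + ν) * besselCoeff ν (k + 1) = -besselCoeff ν k := by
  have hk := k.cast_nonneg (α := ℝ)
  have h1 : Real.Gamma ((k : ℝ) + ν + 1) ≠ 0 := (Real.Gamma_pos_of_pos (by linarith)).ne'
  have h2 : (k : ℝ) + ν + 1 ≠ 0 := by linarith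
  have h3 : Real.Gamma (((k + 1 : ℕ) : ℝ) + ν + 1) =
      ((k : ℝ) + ν + 1) * Real.Gamma ((k : ℝ) + ν + 1) := by
    rw [← Real.Gamma_add_one h2]; push_cast; ring_nf
  unfold besselCoeff
  rw [h3, Nat.factorial_succ]
  push_cast
  field_simp
  ring

theorem summable_besselCoeff_mul_pow {ν : ℝ} (hν : -1 < ν) (y : ℝ) :
    Summable fun k => ‖besselCoeff ν k * y ^ k‖ := by
  by_cases hy : y = 0
  · refine summable_of_ne_finset_zero (s := {0}) fun k hk => ?_
    simp only [Finset.mem_singleton] at hk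
    simp [hy, hk]
  refine Summable.norm (summable_of_ratio_test_tendsto_lt_one zero_lt_one
    (Eventually.of_forall fun k => mul_ne_zero (besselCoeff_ne_zero hν k) (pow_ne_zero _ hy)) ?_)
  have hlim : Tendsto (fun k : ℕ => |y| / (4 * ((k : ℝ) + 1) * ((k : ℝ) + 1 + ν))) atTop (𝓝 0) := by
    refine tendsto_const_nhds.div_atTop ?_
    refine Tendsto.atTop_mul_atTop₀ ?_ ?_
    · exact (tendsto_natCast_atTop_atTop.atTop_add tendsto_const_nhds).const_mul_atTop (by norm_num)
    · exact (tendsto_natCast_atTop_atTop.atTop_add tendsto_const_nhds).atTop_add tendsto_const_nhds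
  refine hlim.congr fun k => ?_
  have hk := k.cast_nonneg (α := ℝ)
  have h2 : 0 < (k : ℝ) + 1 + ν := by linarith
  have hc := besselCoeff_ne_zero hν k
  have hc' := besselCoeff_succ hν k
  have : |besselCoeff ν k| = 4 * ((k : ℝ) + 1) * ((k : ℝ) + 1 + ν) * |besselCoeff ν (k + 1)| := by
    rw [← abs_neg, ← hc', abs_mul, abs_of_pos (by positivity)]
  have hc1 := abs_pos.2 (besselCoeff_ne_zero hν (k + 1))
  have hy' := abs_pos.2 hy
  simp only [norm_mul, norm_pow, Real.norm_eq_abs]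
  rw [this, pow_succ]
  field_simp

/-- Sequences of at most geometric growth. -/
def GeomBounded (w : ℕ → ℝ) : Prop := ∃ C A : ℝ, 0 ≤ C ∧ 0 ≤ A ∧ ∀ k, |w k| ≤ C * A ^ k

theorem GeomBounded.mul {v w : ℕ → ℝ} (hv : GeomBounded v) (hw : GeomBounded w) :
    GeomBounded fun k => v k * w k := by
  obtain ⟨C, A, hC, hA, h⟩ := hv
  obtain ⟨D, B, hD, hB, h'⟩ := hw
  refine ⟨C * D, A * B, by positivity, by positivity, fun k => ?_⟩
  rw [abs_mul, mul_pow]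
  calc |v k| * |w k| ≤ (C * A ^ k) * (D * B ^ k) := by gcongr <;> simp_all
    _ = _ := by ring

theorem geomBounded_affine (a b : ℝ) : GeomBounded fun k => a * k + b := by
  refine ⟨|a| + |b|, 2, by positivity, by norm_num, fun k => ?_⟩
  have h1 : (k : ℝ) ≤ 2 ^ k := by exact_mod_cast k.lt_two_pow_self.le
  have h2 : (1 : ℝ) ≤ 2 ^ k := one_le_pow₀ (by norm_num)
  calc |a * k + b| ≤ |a| * k + |b| * 1 := by
        refine (abs_add_le _ _).trans ?_
        rw [abs_mul, Nat.abs_cast, mul_one]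
    _ ≤ |a| * 2 ^ k + |b| * 2 ^ k := by gcongr
    _ = _ := by ring

/-- The series `∑ w_k c_k x^(2k)` with `c_k` the Bessel coefficients. -/
noncomputable def besselSeries (ν : ℝ) (w : ℕ → ℝ) (x : ℝ) : ℝ :=
  ∑' k : ℕ, w k * besselCoeff ν k * x ^ (2 * k)

theorem GeomBounded.summable {w : ℕ → ℝ} (hw : GeomBounded w) {ν : ℝ} (hν : -1 < ν) (x : ℝ) :
    Summable fun k => ‖w k * besselCoeff ν k * x ^ (2 * k)‖ := by
  obtain ⟨C, A, hC, hA, h⟩ := hw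
  refine Summable.of_nonneg_of_le (fun k => norm_nonneg _) (fun k => ?_)
    ((summable_besselCoeff_mul_pow hν (A * x ^ 2)).mul_left C)
  have hx : 0 ≤ (x ^ 2) ^ k := by positivity
  simp only [norm_mul, norm_pow, Real.norm_eq_abs, mul_pow, abs_of_nonneg hA, pow_mul]
  calc |w k| * |besselCoeff ν k| * (|x| ^ 2) ^ k
      ≤ (C * A ^ k) * |besselCoeff ν k| * (|x| ^ 2) ^ k := by gcongr; exact h k
    _ = _ := by ring

theorem GeomBounded.summable' {w : ℕ → ℝ} (hw : GeomBounded w) {ν : ℝ} (hν : -1 < ν) (x : ℝ) :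
    Summable fun k => w k * besselCoeff ν k * x ^ (2 * k) := (hw.summable hν x).of_norm

theorem besselSeries_add {ν : ℝ} (hν : -1 < ν) {v w : ℕ → ℝ} (hv : GeomBounded v)
    (hw : GeomBounded w) (x : ℝ) :
    besselSeries ν (fun k => v k + w k) x = besselSeries ν v x + besselSeries ν w x := by
  unfold besselSeries
  rw [← (hv.summable' hν x).tsum_add (hw.summable' hν x)]
  exact tsum_congr fun k => by ring

theorem besselSeries_const_mul (ν a : ℝ) (w : ℕ → ℝ) (x : ℝ) :
    besselSeries ν (fun k => a * w k) x = a * besselSeries ν w x := by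
  unfold besselSeries
  rw [← tsum_mul_left]
  exact tsum_congr fun k => by ring

theorem besselSeries_at_zero (ν : ℝ) (w : ℕ → ℝ) :
    besselSeries ν w 0 = w 0 * besselCoeff ν 0 := by
  unfold besselSeries
  rw [tsum_eq_single 0 fun k hk => by simp [hk]]
  simp

/-- Termwise differentiation. -/
theorem GeomBounded.hasDerivAt_tsum {w : ℕ → ℝ} (hw : GeomBounded w) {ν : ℝ} (hν : -1 < ν)
    (x : ℝ) : HasDerivAt (besselSeries ν w)
      (∑' k : ℕ, w k * besselCoeff ν k * ((2 * k : ℕ) * x ^ (2 * k - 1))) x := by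
  have hw2 : GeomBounded fun k => w k * (2 * k + 0) := hw.mul (geomBounded_affine 2 0)
  refine hasDerivAt_tsum_of_isPreconnected (hw2.summable hν (|x| + 1))
    (Metric.isOpen_ball (x := (0 : ℝ)) (ε := |x| + 1)) (convex_ball _ _).isPreconnected
    (g := fun (k : ℕ) (y : ℝ) => w k * besselCoeff ν k * y ^ (2 * k))
    (fun k y _ => (hasDerivAt_pow (2 * k) y).const_mul _) (fun k y hy => ?_)
    (Metric.mem_ball_self (by positivity)) (hw.summable' hν 0) (by simp)
  have hy : |y| ≤ |x| + 1 := by simpa using (mem_ball_zero_iff.1 hy).le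
  -- The radius |x| + 1 is at least 1, so raising the exponent only increases the majorant.
  have h1 : |y| ^ (2 * k - 1) ≤ (|x| + 1) ^ (2 * k) :=
    (pow_le_pow_left₀ (abs_nonneg _) hy _).trans
      (pow_le_pow_right₀ (by linarith [abs_nonneg x]) (by omega))
  simp only [norm_mul, norm_pow, Real.norm_eq_abs, add_zero]
  rw [abs_of_nonneg (by positivity : (0 : ℝ) ≤ |x| + 1)]
  push_cast
  simp only [abs_mul, Nat.abs_cast, abs_two]
  calc |w k| * |besselCoeff ν k| * (2 * k * |y| ^ (2 * k - 1))
      ≤ |w k| * |besselCoeff ν k| * (2 * k * (|x| + 1) ^ (2 * k)) := by gcongr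
    _ = _ := by ring

theorem GeomBounded.continuous {w : ℕ → ℝ} (hw : GeomBounded w) {ν : ℝ} (hν : -1 < ν) :
    Continuous (besselSeries ν w) :=
  continuous_iff_continuousAt.2 fun x => (hw.hasDerivAt_tsum hν x).continuousAt

/-- The Euler operator `x d/dx` acts on the weights by multiplication with `2k`. -/
theorem GeomBounded.hasDerivAt {w : ℕ → ℝ} (hw : GeomBounded w) {ν : ℝ} (hν : -1 < ν)
    {x : ℝ} (hx : x ≠ 0) : HasDerivAt (besselSeries ν w)
      (besselSeries ν (fun k => 2 * k * w k) x / x) x := by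
  convert hw.hasDerivAt_tsum hν x using 1
  rw [div_eq_iff hx, ← tsum_mul_right]
  refine tsum_congr fun k => ?_
  cases k with
  | zero => simp
  | succ k =>
    rw [show 2 * (k + 1) = 2 * (k + 1) - 1 + 1 by omega, pow_succ, Nat.add_sub_cancel]
    push_cast [show 2 * (k + 1) - 1 = 2 * k + 1 by omega]
    ring

/-- The Bessel equation. -/
theorem besselSeries_ode {ν : ℝ} (hν : -1 < ν) (x : ℝ) :
    besselSeries ν (fun k => 4 * k * (k + ν)) x = -x ^ 2 * besselSeries ν (fun _ => 1) x := by
  have hw : GeomBounded fun k : ℕ => 4 * (k : ℝ) * (k + ν) := by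
    simpa using (geomBounded_affine 4 0).mul (geomBounded_affine 1 ν)
  unfold besselSeries
  rw [(hw.summable' hν x).tsum_eq_zero_add, ← tsum_mul_left]
  simp only [Nat.cast_zero, mul_zero, zero_mul, zero_add, one_mul]
  refine tsum_congr fun k => ?_
  have := besselCoeff_succ hν k
  push_cast
  rw [this, mul_add, pow_add]
  ring

/-! ### Approximation by Laguerre polynomials -/

theorem tendsto_descFactorial_div_pow (k : ℕ) :
    Tendsto (fun n : ℕ => (n.descFactorial k : ℝ) / (n : ℝ) ^ k) atTop (𝓝 1) := by
  have h := isEquivalent_descFactorial k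
  refine (Asymptotics.isEquivalent_iff_tendsto_one ?_).1 h
  filter_upwards [eventually_gt_atTop 0] with n hn
  positivity

theorem descFactorial_div_pow_le_one (n k : ℕ) : (n.descFactorial k : ℝ) / (n : ℝ) ^ k ≤ 1 := by
  refine div_le_one_of_le₀ ?_ (by positivity)
  exact_mod_cast Nat.descFactorial_le_pow n k

/-- A Bessel series is the limit of finite sums obtained by inserting the factors
`n (n-1) ⋯ (n-k+1) / n^k`. -/
theorem GeomBounded.tendsto_sum {w : ℕ → ℝ} (hw : GeomBounded w) {ν : ℝ} (hν : -1 < ν) (x : ℝ) :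
    Tendsto (fun n : ℕ => ∑ k ∈ Finset.range (n + 1),
      w k * besselCoeff ν k * x ^ (2 * k) * ((n.descFactorial k : ℝ) / (n : ℝ) ^ k))
      atTop (𝓝 (besselSeries ν w x)) := by
  have h : Tendsto (fun n : ℕ => ∑' k,
      w k * besselCoeff ν k * x ^ (2 * k) * ((n.descFactorial k : ℝ) / (n : ℝ) ^ k))
      atTop (𝓝 (besselSeries ν w x)) := by
    -- The inserted factors lie in [0, 1] and tend to 1, so the series itself dominates.
    refine tendsto_tsum_of_dominated_convergence (hw.summable hν x) (fun k => ?_)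
      (Eventually.of_forall fun n k => ?_)
    · simpa using (tendsto_descFactorial_div_pow k).const_mul
        (w k * besselCoeff ν k * x ^ (2 * k))
    · rw [norm_mul]
      refine mul_le_of_le_one_right (norm_nonneg _) ?_
      rw [Real.norm_of_nonneg (by positivity)]
      exact descFactorial_div_pow_le_one n k
  refine h.congr fun n => tsum_eq_sum fun k hk => ?_
  rw [Nat.descFactorial_of_lt (by simpa using hk)]
  simp

open Polynomial in
/-- The Laguerre polynomials of order `ν`, normalized to take the value `1` at the origin. -/
noncomputable def laguerrePoly (ν : ℝ) (n : ℕ) : ℝ[X] :=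
  ∑ k ∈ Finset.range (n + 1), C (4 ^ k * n.descFactorial k * besselCoeff ν k) * X ^ k

open Polynomial in
theorem coeff_laguerrePoly (ν : ℝ) (n k : ℕ) :
    (laguerrePoly ν n).coeff k = 4 ^ k * n.descFactorial k * besselCoeff ν k := by
  simp only [laguerrePoly, finsetSum_coeff, coeff_C_mul_X_pow]
  rw [Finset.sum_ite_eq]
  split_ifs with h
  · rfl
  · rw [Nat.descFactorial_of_lt (by simpa using h)]
    simp

theorem succ_descFactorial_succ_cast (n k : ℕ) :
    ((n + 1).descFactorial (k + 1) : ℝ) =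
      n.descFactorial (k + 1) + (k + 1) * n.descFactorial k := by
  rw [Nat.succ_descFactorial_succ, Nat.descFactorial_succ]
  rcases le_or_gt k n with h | h
  · push_cast [Nat.cast_sub h]; ring
  · simp [Nat.descFactorial_of_lt h]

theorem descFactorial_succ_cast (n k : ℕ) :
    (n.descFactorial (k + 1) : ℝ) = (n - k) * n.descFactorial k := by
  rw [Nat.descFactorial_succ]
  rcases le_or_gt k n with h | h
  · push_cast [Nat.cast_sub h]; ring
  · simp [Nat.descFactorial_of_lt h]

-- A recurrence that raises n at fixed ν by a first-order operator; after x ↦ x² this operator is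
-- the one in `splits_laguerre_step`.
open Polynomial in
theorem laguerrePoly_succ {ν : ℝ} (hν : -1 < ν) (n : ℕ) :
    C (n + 1 + ν) * laguerrePoly ν (n + 1) =
      X * derivative (laguerrePoly ν n) + (C (n + 1 + ν) - X) * laguerrePoly ν n := by
  ext k
  cases k with
  | zero => simp [sub_mul, coeff_laguerrePoly]
  | succ k =>
    simp only [coeff_add, coeff_C_mul, coeff_X_mul, coeff_derivative, sub_mul, coeff_sub,
      coeff_laguerrePoly, succ_descFactorial_succ_cast]
    have h := besselCoeff_succ hν k
    rw [descFactorial_succ_cast]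
    linear_combination (4 ^ k * (n.descFactorial k : ℝ)) * h

open Polynomial in
theorem splits_laguerrePoly_comp_sq {ν : ℝ} (hν : -1 < ν) (n : ℕ) :
    ((laguerrePoly ν n).comp (X ^ 2)).Splits := by
  induction n with
  | zero => simp [laguerrePoly]
  | succ n ih =>
    -- Since x d/dx of L(x²) is twice (x L')(x²), the recurrence is doubled before substituting x².
    have hc : (0 : ℝ) < 2 * (n + 1 + ν) := by have := n.cast_nonneg (α := ℝ); linarith
    have h := splits_laguerre_step ih hc
    have heq : X * derivative ((laguerrePoly ν n).comp (X ^ 2)) +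
        (C (2 * (n + 1 + ν)) - C 2 * X ^ 2) * (laguerrePoly ν n).comp (X ^ 2) =
        C (2 * (n + 1 + ν)) * (laguerrePoly ν (n + 1)).comp (X ^ 2) := by
      have := congrArg (fun p => C 2 * p.comp (X ^ 2)) (laguerrePoly_succ hν n)
      simp only [mul_comp, add_comp, sub_comp, C_comp, X_comp] at this
      rw [C_mul, mul_assoc, this, derivative_comp]
      simp only [derivative_X_pow, C_add, C_1]
      push_cast
      ring
    rw [heq] at h
    have h' := h.C_mul (2 * (n + 1 + ν))⁻¹
    rwa [← mul_assoc, ← C_mul, inv_mul_cancel₀ hc.ne', C_1, one_mul] at h'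

open Polynomial in
/-- The polynomials `(x L(x²))'`, where `L` is a Laguerre polynomial. -/
noncomputable def diniPoly (ν : ℝ) (n : ℕ) : ℝ[X] :=
  derivative (X * (laguerrePoly ν n).comp (X ^ 2))

open Polynomial in
theorem diniPoly_eq (ν : ℝ) (n : ℕ) : diniPoly ν n = ∑ k ∈ Finset.range (n + 1),
    C ((2 * k + 1) * (4 ^ k * n.descFactorial k * besselCoeff ν k)) * X ^ (2 * k) := by
  unfold diniPoly laguerrePoly
  rw [sum_comp, Finset.mul_sum, derivative_sum]
  refine Finset.sum_congr rfl fun k _ => ?_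
  rw [mul_comp, C_comp, pow_comp, X_comp, ← pow_mul,
    show X * (C (4 ^ k * n.descFactorial k * besselCoeff ν k) * X ^ (2 * k)) =
      C (4 ^ k * n.descFactorial k * besselCoeff ν k) * X ^ (2 * k + 1) by ring,
    derivative_C_mul_X_pow]
  push_cast
  rw [mul_comm (2 * (k : ℝ) + 1)]

open Polynomial in
/-- The Laguerre inequality for the function `∑ (2k+1) c_k x^(2k)`. -/
theorem besselSeries_laguerre {ν : ℝ} (hν : -1 < ν) (x : ℝ) :
    besselSeries ν (fun k => 2 * k + 1) x *
      besselSeries ν (fun k => (2 * k - 1) * (2 * k * (2 * k + 1))) x ≤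
      besselSeries ν (fun k => 2 * k * (2 * k + 1)) x ^ 2 := by
  have hw0 : GeomBounded fun k : ℕ => 2 * (k : ℝ) + 1 := geomBounded_affine 2 1
  have hw1 : GeomBounded fun k : ℕ => 2 * (k : ℝ) * (2 * k + 1) := by
    simpa using (geomBounded_affine 2 0).mul hw0
  have hw2 : GeomBounded fun k : ℕ => (2 * (k : ℝ) - 1) * (2 * k * (2 * k + 1)) :=
    (geomBounded_affine 2 (-1)).mul hw1
  refine le_of_tendsto_of_tendsto ((hw0.tendsto_sum hν x).mul (hw2.tendsto_sum hν x))
    ((hw1.tendsto_sum hν x).pow 2) ?_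
  filter_upwards [eventually_gt_atTop 0] with n hn
  have hn' : (0 : ℝ) < n := by exact_mod_cast hn
  -- This scaling turns 4^k y^(2k) into x^(2k) / n^k, producing the factors of
  -- `GeomBounded.tendsto_sum`.
  set y : ℝ := x / (2 * √n) with hy
  have hy2 : 4 * y ^ 2 = x ^ 2 / n := by
    rw [hy, div_pow, mul_pow, Real.sq_sqrt hn'.le]; field_simp; ring
  have hyk (k : ℕ) : 4 ^ k * y ^ (2 * k) = x ^ (2 * k) / (n : ℝ) ^ k := by
    rw [pow_mul, ← mul_pow, hy2, div_pow, pow_mul]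
  have hs : (diniPoly ν n).Splits :=
    splits_derivative_of_splits (Splits.X.mul (splits_laguerrePoly_comp_sq hν n))
  -- The factor y² leaves only y p' and y² p'', whose weights are polynomials in k; no division by y
  -- is needed.
  have hL := mul_le_mul_of_nonneg_left (laguerre_inequality hs y) (sq_nonneg y)
  have e0 : (diniPoly ν n).eval y = ∑ k ∈ Finset.range (n + 1),
      (2 * (k : ℝ) + 1) * besselCoeff ν k * x ^ (2 * k) *
        ((n.descFactorial k : ℝ) / (n : ℝ) ^ k) := by
    rw [diniPoly_eq, eval_finsetSum]
    refine Finset.sum_congr rfl fun k _ => ?_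
    simp only [eval_mul, eval_C, eval_pow, eval_X]
    linear_combination ((2 * (k : ℝ) + 1) * n.descFactorial k * besselCoeff ν k) * hyk k
  have e1 : y * (derivative (diniPoly ν n)).eval y = ∑ k ∈ Finset.range (n + 1),
      (2 * (k : ℝ) * (2 * k + 1)) * besselCoeff ν k * x ^ (2 * k) *
        ((n.descFactorial k : ℝ) / (n : ℝ) ^ k) := by
    rw [diniPoly_eq, derivative_sum, eval_finsetSum, Finset.mul_sum]
    refine Finset.sum_congr rfl fun k _ => ?_
    have hp : y * ((2 * k : ℕ) * y ^ (2 * k - 1)) = 2 * k * y ^ (2 * k) := by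
      rcases k with _ | k
      · simp
      · rw [show 2 * (k + 1) - 1 = 2 * k + 1 by omega]; push_cast; ring
    simp only [derivative_C_mul_X_pow, eval_mul, eval_C, eval_pow, eval_X]
    linear_combination ((2 * (k : ℝ) + 1) * n.descFactorial k * besselCoeff ν k) *
      (4 ^ k * hp + 2 * k * hyk k)
  have e2 : y ^ 2 * (derivative (derivative (diniPoly ν n))).eval y =
      ∑ k ∈ Finset.range (n + 1),
      ((2 * (k : ℝ) - 1) * (2 * k * (2 * k + 1))) * besselCoeff ν k * x ^ (2 * k) *
        ((n.descFactorial k : ℝ) / (n : ℝ) ^ k) := by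
    rw [diniPoly_eq, derivative_sum, derivative_sum, eval_finsetSum, Finset.mul_sum]
    refine Finset.sum_congr rfl fun k _ => ?_
    have hp : y ^ 2 * ((2 * k : ℕ) * ((2 * k - 1 : ℕ) * y ^ (2 * k - 1 - 1))) =
        (2 * k - 1) * (2 * k) * y ^ (2 * k) := by
      rcases k with _ | k
      · simp
      · rw [show 2 * (k + 1) - 1 = 2 * k + 1 by omega, Nat.add_sub_cancel]; push_cast; ring
    simp only [derivative_C_mul_X_pow, eval_mul, eval_C, eval_pow, eval_X]
    linear_combination ((2 * (k : ℝ) + 1) * n.descFactorial k * besselCoeff ν k) *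
      (4 ^ k * hp + (2 * k - 1) * (2 * k) * hyk k)
  rw [← e0, ← e1, ← e2]
  linarith

/-! ### The functions j, x j' and D, and their derivatives -/

/-- The entire function `2^ν Γ(ν+1) x^(-ν) J_ν(x)`. -/
noncomputable def besselEntire (ν : ℝ) : ℝ → ℝ := besselSeries ν fun _ => 1

/-- The image of `besselEntire` under the Euler operator `x d/dx`. -/
noncomputable def besselEuler (ν : ℝ) : ℝ → ℝ := besselSeries ν fun k => 2 * k

/-- The entire function `2^ν Γ(ν+1) x^(-ν) d_ν(x)`. -/
noncomputable def diniEntire (ν : ℝ) : ℝ → ℝ := besselSeries ν fun k => 2 * k + 1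

theorem geomBounded_one : GeomBounded fun _ => 1 := by
  simpa using geomBounded_affine 0 1

theorem geomBounded_two_mul : GeomBounded fun k => 2 * (k : ℝ) := by
  simpa using geomBounded_affine 2 0

theorem diniEntire_eq {ν : ℝ} (hν : -1 < ν) (x : ℝ) :
    diniEntire ν x = besselEntire ν x + besselEuler ν x := by
  rw [add_comm]
  exact besselSeries_add hν geomBounded_two_mul geomBounded_one x

theorem hasDerivAt_besselEntire {ν : ℝ} (hν : -1 < ν) {x : ℝ} (hx : x ≠ 0) :
    HasDerivAt (besselEntire ν) (besselEuler ν x / x) x := by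
  have h := geomBounded_one.hasDerivAt hν hx
  simp only [mul_one] at h
  exact h

theorem hasDerivAt_besselEuler {ν : ℝ} (hν : -1 < ν) {x : ℝ} (hx : x ≠ 0) :
    HasDerivAt (besselEuler ν)
      ((-2 * ν * besselEuler ν x - x ^ 2 * besselEntire ν x) / x) x := by
  refine (geomBounded_two_mul.hasDerivAt hν hx).congr_deriv (congrArg (· / x) ?_)
  have h := besselSeries_ode hν x
  have h1 : (fun k : ℕ => 4 * (k : ℝ) * (k + ν)) =
      fun k : ℕ => 2 * (k : ℝ) * (2 * k) + 2 * ν * (2 * k) := by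
    ext k; ring
  rw [h1, besselSeries_add hν (geomBounded_two_mul.mul geomBounded_two_mul)
    (by simpa [← mul_assoc] using geomBounded_affine (2 * ν * 2) 0),
    besselSeries_const_mul] at h
  unfold besselEuler besselEntire
  linear_combination h

theorem continuous_besselEntire {ν : ℝ} (hν : -1 < ν) : Continuous (besselEntire ν) :=
  geomBounded_one.continuous hν

theorem continuous_diniEntire {ν : ℝ} (hν : -1 < ν) : Continuous (diniEntire ν) :=
  GeomBounded.continuous (geomBounded_affine 2 1) hν

theorem diniEntire_zero {ν : ℝ} (hν : -1 < ν) : diniEntire ν 0 = 1 := by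
  simp [diniEntire, besselSeries_at_zero, besselCoeff_zero hν]

theorem hasDerivAt_diniEntire {ν : ℝ} (hν : -1 < ν) {x : ℝ} (hx : x ≠ 0) :
    HasDerivAt (diniEntire ν)
      (((1 - 2 * ν) * besselEuler ν x - x ^ 2 * besselEntire ν x) / x) x := by
  have h : diniEntire ν = fun x => besselEntire ν x + besselEuler ν x :=
    funext (diniEntire_eq hν)
  rw [h]
  refine HasDerivAt.congr_deriv ((hasDerivAt_besselEntire hν hx).add (hasDerivAt_besselEuler hν hx)) ?_
  ring

theorem hasDerivAt_id_mul_besselEntire {ν : ℝ} (hν : -1 < ν) {x : ℝ} (hx : x ≠ 0) :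
    HasDerivAt (fun y => y * besselEntire ν y) (diniEntire ν x) x := by
  refine HasDerivAt.congr_deriv ((hasDerivAt_id x).mul (hasDerivAt_besselEntire hν hx)) ?_
  rw [diniEntire_eq hν]
  simp
  field_simp

/-! ### Simplicity of the positive zeros of D -/

theorem geomBounded_inv_add {ν : ℝ} (hν : -1 < ν) : GeomBounded fun k => 1 / ((k : ℝ) + 1 + ν) := by
  have h1 : 0 < 1 + ν := by linarith
  refine ⟨1 / (1 + ν), 1, by positivity, by norm_num, fun k => ?_⟩
  have hk := k.cast_nonneg (α := ℝ)
  have h2 : 0 < (k : ℝ) + 1 + ν := by linarith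
  rw [one_pow, mul_one, abs_of_pos (by positivity)]
  exact one_div_le_one_div_of_le h1 (by linarith)

/-- Extracts the factor x² from x j', which governs the Lommel form near 0. -/
theorem besselEuler_eq {ν : ℝ} (hν : -1 < ν) (x : ℝ) :
    besselEuler ν x = -(x ^ 2 / 2) * besselSeries ν (fun k => 1 / ((k : ℝ) + 1 + ν)) x := by
  unfold besselEuler besselSeries
  have hs := geomBounded_two_mul.summable' hν x
  rw [hs.tsum_eq_zero_add, ← tsum_mul_left]
  simp only [Nat.cast_zero, mul_zero, zero_mul, zero_add]
  refine tsum_congr fun k => ?_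
  have h2 : (k : ℝ) + 1 + ν ≠ 0 := by have := k.cast_nonneg (α := ℝ); linarith
  have := besselCoeff_succ hν k
  rw [mul_add, pow_add, ← neg_eq_iff_eq_neg.2 this]
  push_cast
  field_simp
  ring

/-- Positivity of the form `∫_0^x t J_ν(t)² dt`. -/
theorem lommel_form_pos {ν : ℝ} (hν : -1 < ν) {x : ℝ} (hx : 0 < x) :
    0 < 2 * ν * besselEntire ν x * besselEuler ν x + besselEuler ν x ^ 2
      + x ^ 2 * besselEntire ν x ^ 2 := by
  set ψ : ℝ → ℝ := fun x => 2 * ν * besselEntire ν x * besselEuler ν x + besselEuler ν x ^ 2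
      + x ^ 2 * besselEntire ν x ^ 2 with hψ
  -- Up to a positive constant, y^(2ν) ψ(y) is (y J_ν')² + (y² - ν²) J_ν², with derivative 2 y J_ν².
  have hder (y : ℝ) (hy : y ∈ Set.Ioi (0 : ℝ)) : HasDerivAt (fun y => y ^ (2 * ν) * ψ y)
      (2 * y ^ (2 * ν) * (y * besselEntire ν y ^ 2)) y := by
    have hy0 : y ≠ 0 := (Set.mem_Ioi.1 hy).ne'
    have hj := hasDerivAt_besselEntire hν hy0
    have hA := hasDerivAt_besselEuler hν hy0
    refine HasDerivAt.congr_deriv ((Real.hasDerivAt_rpow_const (p := 2 * ν) (Or.inl hy0)).mul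
      ((((hj.const_mul (2 * ν)).mul hA).add (hA.pow 2)).add
        ((hasDerivAt_pow 2 y).mul (hj.pow 2)))) ?_
    simp only [hψ, Real.rpow_sub_one hy0]
    field_simp
    norm_num
    ring
  have hmono : MonotoneOn (fun y => y ^ (2 * ν) * ψ y) (Set.Ioi 0) := by
    refine monotoneOn_of_hasDerivWithinAt_nonneg (convex_Ioi 0)
      (fun y hy => (hder y hy).continuousAt.continuousWithinAt)
      (f' := fun y => 2 * y ^ (2 * ν) * (y * besselEntire ν y ^ 2)) ?_ ?_
    · rw [interior_Ioi]
      exact fun y hy => (hder y hy).hasDerivWithinAt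
    · rw [interior_Ioi]
      intro y hy
      have : 0 < y := hy
      positivity
  set D := besselSeries ν (fun k => 1 / ((k : ℝ) + 1 + ν)) with hD
  have hDc : Continuous D := (geomBounded_inv_add hν).continuous hν
  have hjc := continuous_besselEntire hν
  have h1 : 0 < 1 + ν := by linarith
  -- The expression is ψ(y)/y² for y ≠ 0, with value 1/(1+ν) > 0 at 0. This gives a positive
  -- starting value even for negative ν.
  have hχ : ∀ᶠ y in 𝓝 (0 : ℝ), 0 < -ν * besselEntire ν y * D y + y ^ 2 * D y ^ 2 / 4
      + besselEntire ν y ^ 2 := by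
    have hc : Continuous fun y => -ν * besselEntire ν y * D y + y ^ 2 * D y ^ 2 / 4
      + besselEntire ν y ^ 2 := by fun_prop
    refine hc.continuousAt.eventually_const_lt ?_
    have : (0 : ℝ) < -ν * 1 * (1 / (1 + ν)) + 1 := by
      rw [show -ν * 1 * (1 / (1 + ν)) + 1 = 1 / (1 + ν) by field_simp; ring]
      positivity
    simpa [hD, besselEntire, besselSeries_at_zero, besselCoeff_zero hν] using this
  obtain ⟨y, hy, hy0, hyx⟩ := ((hχ.filter_mono nhdsWithin_le_nhds).and
    (Ioo_mem_nhdsGT hx)).exists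
  have hψy : ψ y = y ^ 2 * (-ν * besselEntire ν y * D y + y ^ 2 * D y ^ 2 / 4
      + besselEntire ν y ^ 2) := by
    simp only [hψ, besselEuler_eq hν]
    ring
  have hpos : 0 < y ^ (2 * ν) * ψ y := by
    rw [hψy]
    have := pow_pos hy0 2
    have := Real.rpow_pos_of_pos hy0 (2 * ν)
    positivity
  have := hpos.trans_le (hmono (Set.mem_Ioi.2 hy0) (Set.mem_Ioi.2 hx) hyx.le)
  exact pos_of_mul_pos_right this (Real.rpow_nonneg hx.le _)

/-- The positive zeros of `diniEntire` are simple. -/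
theorem deriv_diniEntire_ne_zero {ν : ℝ} (hν : -1 < ν) {x : ℝ} (hx : 0 < x)
    (h : diniEntire ν x = 0) : deriv (diniEntire ν) x ≠ 0 := by
  rw [(hasDerivAt_diniEntire hν hx.ne').deriv]
  have hψ := lommel_form_pos hν hx
  rw [diniEntire_eq hν] at h
  -- Under x j' = -j the Lommel form equals -j · x D', so D' = 0 would make it vanish.
  have hA : besselEuler ν x = -besselEntire ν x := by linarith
  rw [hA] at hψ ⊢
  intro h0
  have h0' : (1 - 2 * ν) * -besselEntire ν x - x ^ 2 * besselEntire ν x = 0 := by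
    simpa [hx.ne'] using h0
  have : 2 * ν * besselEntire ν x * -besselEntire ν x + (-besselEntire ν x) ^ 2
      + x ^ 2 * besselEntire ν x ^ 2 = 0 := by
    linear_combination -besselEntire ν x * h0'
  linarith

/-! ### Existence of arbitrarily large zeros -/

/-- Sturm comparison with `sin ((x - a) / 2)`. -/
theorem not_pos_of_sturm {u v q : ℝ → ℝ} {a : ℝ}
    (hu : ∀ x ∈ Set.Icc a (a + 2 * Real.pi), HasDerivAt u (v x) x)
    (hv : ∀ x ∈ Set.Icc a (a + 2 * Real.pi), HasDerivAt v (-(q x) * u x) x)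
    (hq : ∀ x ∈ Set.Icc a (a + 2 * Real.pi), 1 / 4 ≤ q x) :
    ¬ ∀ x ∈ Set.Icc a (a + 2 * Real.pi), 0 < u x := by
  intro hpos
  have hπ := Real.pi_pos
  have hs (x : ℝ) : HasDerivAt (fun x => Real.sin ((x - a) / 2)) (Real.cos ((x - a) / 2) * (1 / 2)) x :=
    (((hasDerivAt_id x).sub_const a).div_const 2).sin
  have hc (x : ℝ) : HasDerivAt (fun x => Real.cos ((x - a) / 2)) (-Real.sin ((x - a) / 2) * (1 / 2)) x :=
    (((hasDerivAt_id x).sub_const a).div_const 2).cos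
  -- The Wronskian of u with the sine is nondecreasing while u > 0, yet falls from u(a)/2 to
  -- -u(a+2π)/2.
  set W : ℝ → ℝ := fun x =>
    u x * Real.cos ((x - a) / 2) / 2 - v x * Real.sin ((x - a) / 2) with hW
  have hWd (x : ℝ) (hx : x ∈ Set.Icc a (a + 2 * Real.pi)) :
      HasDerivAt W ((q x - 1 / 4) * u x * Real.sin ((x - a) / 2)) x := by
    refine HasDerivAt.congr_deriv ((((hu x hx).mul (hc x)).div_const 2).sub ((hv x hx).mul (hs x))) ?_
    ring
  have hmono : MonotoneOn W (Set.Icc a (a + 2 * Real.pi)) := by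
    refine monotoneOn_of_hasDerivWithinAt_nonneg (convex_Icc _ _)
      (fun x hx => (hWd x hx).continuousAt.continuousWithinAt)
      (fun x hx => (hWd x (interior_subset hx)).hasDerivWithinAt) fun x hx => ?_
    have hx' := interior_subset hx
    refine mul_nonneg (mul_nonneg (by linarith [hq x hx']) (hpos x hx').le) ?_
    exact Real.sin_nonneg_of_nonneg_of_le_pi (by linarith [hx'.1]) (by linarith [hx'.2])
  have h1 := hmono (Set.left_mem_Icc.2 (by linarith)) (Set.right_mem_Icc.2 (by linarith))
    (by linarith)
  simp only [hW, sub_self, zero_div, Real.cos_zero, Real.sin_zero, add_sub_cancel_left,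
    mul_div_cancel_left₀ Real.pi (two_ne_zero' ℝ), Real.cos_pi, Real.sin_pi] at h1
  have h2 := hpos a (Set.left_mem_Icc.2 (by linarith))
  have h3 := hpos (a + 2 * Real.pi) (Set.right_mem_Icc.2 (by linarith))
  linarith

/-- `besselEntire` has arbitrarily large zeros. -/
theorem exists_besselEntire_eq_zero {ν : ℝ} (hν : -1 < ν) (M : ℝ) :
    ∃ x, M < x ∧ besselEntire ν x = 0 := by
  by_contra! hne
  -- Beyond a we have x > M and x ≥ 2|ν|, so ν²/x² ≤ 1/4 and the potential below stays above 1/4.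
  set a : ℝ := |M| + 2 * |ν| + 1 with ha
  have hνa := abs_nonneg ν
  have hMa := abs_nonneg M
  have hMl := le_abs_self M
  set I := Set.Icc a (a + 2 * Real.pi)
  have hI {x : ℝ} (hx : x ∈ I) : 0 < x := by linarith [hx.1]
  have hsign : (∀ x ∈ I, 0 < besselEntire ν x) ∨ ∀ x ∈ I, 0 < -besselEntire ν x := by
    by_contra! hcon
    obtain ⟨⟨x, hx, hx'⟩, y, hy, hy'⟩ := hcon
    obtain ⟨z, hz, hz'⟩ := isPreconnected_Icc.intermediate_value hx hy
      (continuous_besselEntire hν).continuousOn ⟨hx', by linarith⟩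
    exact hne z (by linarith [hz.1]) hz'
  -- Up to a constant this is √x J_ν(x), which removes the first-order term of Bessel's equation; s
  -- = ±1 fixes the sign.
  have hu (s : ℝ) (x : ℝ) (hx : x ∈ I) :
      HasDerivAt (fun x => x ^ (ν + 1 / 2) * (s * besselEntire ν x))
      (s * (x ^ (ν - 1 / 2) * ((ν + 1 / 2) * besselEntire ν x + besselEuler ν x))) x := by
    have hx0 := (hI hx).ne'
    refine HasDerivAt.congr_deriv ((Real.hasDerivAt_rpow_const (p := ν + 1 / 2) (Or.inl hx0)).mul
      ((hasDerivAt_besselEntire hν hx0).const_mul s)) ?_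
    rw [show ν + 1 / 2 - 1 = ν - 1 / 2 by ring, show ν + 1 / 2 = ν - 1 / 2 + 1 by ring,
      Real.rpow_add_one hx0]
    field_simp
  have hv (s : ℝ) (x : ℝ) (hx : x ∈ I) :
      HasDerivAt (fun x =>
        s * (x ^ (ν - 1 / 2) * ((ν + 1 / 2) * besselEntire ν x + besselEuler ν x)))
      (-(1 + (1 / 4 - ν ^ 2) / x ^ 2) * (x ^ (ν + 1 / 2) * (s * besselEntire ν x))) x := by
    have hx0 := (hI hx).ne'
    refine HasDerivAt.congr_deriv (((Real.hasDerivAt_rpow_const (p := ν - 1 / 2) (Or.inl hx0)).mul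
      (((hasDerivAt_besselEntire hν hx0).const_mul (ν + 1 / 2)).add
        (hasDerivAt_besselEuler hν hx0))).const_mul s) ?_
    rw [Pi.add_apply, Real.rpow_sub_one hx0, show ν + 1 / 2 = ν - 1 / 2 + 1 by ring, Real.rpow_add_one hx0]
    field_simp
    ring
  have hq (x : ℝ) (hx : x ∈ I) : 1 / 4 ≤ 1 + (1 / 4 - ν ^ 2) / x ^ 2 := by
    have h0 := hI hx
    have h1 : 2 * |ν| ≤ x := by linarith [hx.1]
    have h2 : 4 * ν ^ 2 ≤ x ^ 2 := by
      rw [← sq_abs ν]; nlinarith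
    have : 0 ≤ (3 / 4 * x ^ 2 + (1 / 4 - ν ^ 2)) / x ^ 2 := by
      apply div_nonneg <;> nlinarith
    rw [add_div, mul_div_cancel_right₀ _ (by positivity)] at this
    linarith
  rcases hsign with h | h
  · exact not_pos_of_sturm (hu 1) (hv 1) hq fun x hx =>
      mul_pos (Real.rpow_pos_of_pos (hI hx) _) (by simpa using h x hx)
  · exact not_pos_of_sturm (hu (-1)) (hv (-1)) hq fun x hx =>
      mul_pos (Real.rpow_pos_of_pos (hI hx) _) (by simpa using h x hx)

/-- Rolle for x j(x) between two zeros of j beyond M. -/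
theorem exists_diniEntire_eq_zero {ν : ℝ} (hν : -1 < ν) {M : ℝ} (hM : 0 ≤ M) :
    ∃ x, M < x ∧ diniEntire ν x = 0 := by
  obtain ⟨x, hx, hx0⟩ := exists_besselEntire_eq_zero hν M
  obtain ⟨y, hy, hy0⟩ := exists_besselEntire_eq_zero hν x
  obtain ⟨z, hz, hz0⟩ := exists_hasDerivAt_eq_zero (f := fun y => y * besselEntire ν y) hy
    (continuous_id.mul (continuous_besselEntire hν)).continuousOn (by simp [hx0, hy0])
    fun z hz => hasDerivAt_id_mul_besselEntire hν (by linarith [hz.1] : 0 < z).ne'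
  exact ⟨z, hx.trans hz.1, hz0⟩

/-! ### Translation to J_ν, d_ν and g_ν -/

theorem besselJ_eq {ν x : ℝ} (hν : -1 < ν) (hx : 0 < x) :
    besselJ ν x = (2 ^ ν * Real.Gamma (ν + 1))⁻¹ * x ^ ν * besselEntire ν x := by
  have hG : Real.Gamma (ν + 1) ≠ 0 := (Real.Gamma_pos_of_pos (by linarith)).ne'
  have h2 : (2 : ℝ) ^ ν ≠ 0 := (Real.rpow_pos_of_pos two_pos ν).ne'
  unfold besselJ besselEntire besselSeries
  rw [← tsum_mul_left]
  refine tsum_congr fun k => ?_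
  have hGk : Real.Gamma ((k : ℝ) + ν + 1) ≠ 0 :=
    (Real.Gamma_pos_of_pos (by have := k.cast_nonneg (α := ℝ); linarith)).ne'
  have h4 : (2 : ℝ) ^ (2 * k) = 4 ^ k := by rw [pow_mul]; norm_num
  rw [Real.rpow_add (by positivity), Real.div_rpow hx.le two_pos.le ν,
    show (2 * (k : ℝ)) = ((2 * k : ℕ) : ℝ) by push_cast; ring, Real.rpow_natCast, div_pow, h4]
  unfold besselCoeff
  field_simp

theorem normBessel_eq {ν x : ℝ} (hν : -1 < ν) (hx : 0 < x) :
    normBessel ν x = x * besselEntire ν x := by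
  have hG : Real.Gamma (ν + 1) ≠ 0 := (Real.Gamma_pos_of_pos (by linarith)).ne'
  have h2 : (2 : ℝ) ^ ν ≠ 0 := (Real.rpow_pos_of_pos two_pos ν).ne'
  have hxν : x ^ ν ≠ 0 := (Real.rpow_pos_of_pos hx ν).ne'
  rw [normBessel, besselJ_eq hν hx, Real.rpow_sub hx, Real.rpow_one]
  field_simp

theorem dini_eq {ν x : ℝ} (hν : -1 < ν) (hx : 0 < x) :
    dini ν x = (2 ^ ν * Real.Gamma (ν + 1))⁻¹ * x ^ ν * diniEntire ν x := by
  have hd : HasDerivAt (besselJ ν) _ x :=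
    ((((Real.hasDerivAt_rpow_const (p := ν) (Or.inl hx.ne')).const_mul
      (2 ^ ν * Real.Gamma (ν + 1))⁻¹).mul (hasDerivAt_besselEntire hν hx.ne'))).congr_of_eventuallyEq
      (by filter_upwards [lt_mem_nhds hx] with y hy using besselJ_eq hν hy)
  rw [dini, hd.deriv, besselJ_eq hν hx, diniEntire_eq hν, Real.rpow_sub_one hx.ne']
  field_simp
  ring

theorem dini_eq_zero_iff {ν x : ℝ} (hν : -1 < ν) (hx : 0 < x) :
    dini ν x = 0 ↔ diniEntire ν x = 0 := by
  have hG : Real.Gamma (ν + 1) ≠ 0 := (Real.Gamma_pos_of_pos (by linarith)).ne'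
  have h2 : (2 : ℝ) ^ ν ≠ 0 := (Real.rpow_pos_of_pos two_pos ν).ne'
  have hxν : x ^ ν ≠ 0 := (Real.rpow_pos_of_pos hx ν).ne'
  rw [dini_eq hν hx]
  simp [hG, h2, hxν]

theorem hasDerivAt_normBessel {ν x : ℝ} (hν : -1 < ν) (hx : 0 < x) :
    HasDerivAt (normBessel ν) (diniEntire ν x) x :=
  (hasDerivAt_id_mul_besselEntire hν hx.ne').congr_of_eventuallyEq
    (by filter_upwards [lt_mem_nhds hx] with y hy using normBessel_eq hν hy)

/-! ### Zeros α_{ν,n} and the sign of D -/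

/-- The sign of a continuous function without zeros on an interval is determined by its sign
next to the left end. -/
theorem pos_on_Ioo_of_eventually_pos {f : ℝ → ℝ} {a b : ℝ} (hf : Continuous f)
    (ha : ∀ᶠ x in 𝓝[>] a, 0 < f x) (hne : ∀ x ∈ Set.Ioo a b, f x ≠ 0) :
    ∀ x ∈ Set.Ioo a b, 0 < f x := by
  intro x hx
  by_contra! hle
  obtain ⟨y, hy, hya, hyx⟩ := (ha.and (Ioo_mem_nhdsGT hx.1)).exists
  obtain ⟨z, hz, hz0⟩ := isPreconnected_Ioo.intermediate_value hx
    (⟨hya, hyx.trans hx.2⟩ : y ∈ Set.Ioo a b) hf.continuousOn ⟨hle, hy.le⟩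
  exact hne z hz hz0

/-- The first zero `b` to the right of `a` of a function which is positive just right of `a`. -/
theorem first_zero_spec {f : ℝ → ℝ} {a : ℝ} (hf : Continuous f)
    (ha : ∀ᶠ x in 𝓝[>] a, 0 < f x) (hex : ∃ x, a < x ∧ f x = 0) :
    a < sInf {x | a < x ∧ f x = 0} ∧ f (sInf {x | a < x ∧ f x = 0}) = 0 ∧
      ∀ x ∈ Set.Ioo a (sInf {x | a < x ∧ f x = 0}), 0 < f x := by
  set S := {x | a < x ∧ f x = 0} with hS
  have hbdd : BddBelow S := ⟨a, fun x hx => hx.1.le⟩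
  obtain ⟨c, hc, hac⟩ := (mem_nhdsGT_iff_exists_Ioo_subset (a := a)).1 ha
  have hlt : a < sInf S := by
    -- Positivity just right of a keeps zeros, hence their infimum, away from a.
    refine lt_of_lt_of_le (Set.mem_Ioi.1 hc) (le_csInf hex fun x hx => ?_)
    by_contra! hxc
    exact (hac ⟨hx.1, hxc⟩ : 0 < f x).ne' hx.2
  refine ⟨hlt, ?_, pos_on_Ioo_of_eventually_pos hf ha fun x hx h0 =>
    (csInf_le hbdd (⟨hx.1, h0⟩ : x ∈ S)).not_gt hx.2⟩
  have hcl : IsClosed {x | f x = 0} := isClosed_eq hf continuous_const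
  exact hcl.closure_subset_iff.2 (fun x hx => hx.2) (csInf_mem_closure hex hbdd)

/-- A positive derivative at b would make f negative just left of b. -/
theorem eventually_neg_right_of_simple_zero {f : ℝ → ℝ} {a b : ℝ} (hab : a < b)
    (hpos : ∀ x ∈ Set.Ioo a b, 0 < f x) (hb : f b = 0) (hd : deriv f b ≠ 0) :
    ∀ᶠ x in 𝓝[>] b, f x < 0 := by
  rcases hd.lt_or_gt with h | h
  · filter_upwards [(eventually_nhdsWithin_sign_eq_of_deriv_neg h hb).filter_mono
      nhdsWithin_le_nhds, self_mem_nhdsWithin] with x hx hxb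
    rwa [sign_neg (sub_neg.2 (Set.mem_Ioi.1 hxb)), sign_eq_neg_one_iff] at hx
  · obtain ⟨x, hx, hxI⟩ := (((eventually_nhdsWithin_sign_eq_of_deriv_pos h hb).filter_mono
      nhdsWithin_le_nhds).and (Ioo_mem_nhdsLT hab)).exists
    rw [sign_neg (sub_neg.2 hxI.2), sign_eq_neg_one_iff] at hx
    exact absurd hx (hpos x hxI).not_gt

/-- The harmless factor s allows `first_zero_spec` to be applied to (-1)^n D, which is positive
right of α_{ν,n}. -/
theorem diniZero_succ {ν : ℝ} (hν : -1 < ν) {n : ℕ} (h : 0 ≤ diniZero ν n) (s : ℝ) (hs : s ≠ 0) :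
    diniZero ν (n + 1) = sInf {x | diniZero ν n < x ∧ s * diniEntire ν x = 0} := by
  rw [diniZero]
  congr 1
  ext x
  refine and_congr_right fun hx => ?_
  rw [dini_eq_zero_iff hν (h.trans_lt hx)]
  simp [hs]

/-- The induction carries the sign right of α_{ν,n}: it makes the next infimum a strictly larger
zero, where simplicity flips the sign. Existence of a further zero excludes the default value of
`sInf` on the empty set. -/
theorem diniZero_spec {ν : ℝ} (hν : -1 < ν) (n : ℕ) :
    0 ≤ diniZero ν n ∧ ∀ᶠ x in 𝓝[>] diniZero ν n, 0 < (-1) ^ n * diniEntire ν x := by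
  induction n with
  | zero =>
    refine ⟨le_rfl, ?_⟩
    have h : 0 < diniEntire ν 0 := by rw [diniEntire_zero hν]; exact one_pos
    simpa [diniZero] using ((continuous_diniEntire hν).continuousAt.eventually_const_lt h).filter_mono
      nhdsWithin_le_nhds
  | succ n ih =>
    obtain ⟨h0, hev⟩ := ih
    have hs : ((-1 : ℝ)) ^ n ≠ 0 := by simp
    obtain ⟨x, hx, hx0⟩ := exists_diniEntire_eq_zero hν h0
    have hspec := first_zero_spec ((continuous_diniEntire hν).const_mul ((-1) ^ n)) hev
      ⟨x, hx, by simp [hx0]⟩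
    rw [← diniZero_succ hν h0 _ hs] at hspec
    obtain ⟨hlt, hzero, hpos⟩ := hspec
    have hpos' : 0 < diniZero ν (n + 1) := h0.trans_lt hlt
    refine ⟨hpos'.le, ?_⟩
    have hsimple := deriv_diniEntire_ne_zero hν hpos' (by simpa [hs] using hzero)
    filter_upwards [eventually_neg_right_of_simple_zero hlt hpos hzero
      (by rw [deriv_const_mul_field]; exact mul_ne_zero hs hsimple)] with x hx
    rw [pow_succ]
    linarith

theorem diniEntire_pos {ν : ℝ} (hν : -1 < ν) {k : ℕ} {x : ℝ} (hx : x ∈ deltaInterval ν k) :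
    0 < x ∧ 0 < diniEntire ν x := by
  obtain ⟨h0, hev⟩ := diniZero_spec hν (2 * k)
  refine ⟨h0.trans_lt hx.1, ?_⟩
  simp only [pow_mul, neg_one_sq, one_pow, one_mul] at hev
  have hspec := first_zero_spec (continuous_diniEntire hν) hev (exists_diniEntire_eq_zero hν h0)
  have h1 := diniZero_succ hν h0 1 one_ne_zero
  simp only [one_mul] at h1
  rw [← h1] at hspec
  exact hspec.2.2 x hx

/-! ### Log-concavity of D -/

theorem concaveOn_log_diniEntire {ν : ℝ} (hν : -1 < ν) (k : ℕ) :
    ConcaveOn ℝ (deltaInterval ν k) fun x => Real.log (diniEntire ν x) := by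
  have hw0 : GeomBounded fun k : ℕ => 2 * (k : ℝ) + 1 := geomBounded_affine 2 1
  have hw1 : GeomBounded fun k : ℕ => 2 * (k : ℝ) * (2 * k + 1) := geomBounded_two_mul.mul hw0
  -- Here E = x D' and F = x E', so F - E = x² D'' and the numerator of (log D)'' is x² (D D'' -
  -- D'^2).
  set E := besselSeries ν (fun k => 2 * k * (2 * k + 1)) with hE
  set F := besselSeries ν (fun k => 2 * k * (2 * k * (2 * k + 1))) with hF
  have hd0 {x : ℝ} (hx : 0 < x) : HasDerivAt (diniEntire ν) (E x / x) x := hw0.hasDerivAt hν hx.ne'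
  have hd1 {x : ℝ} (hx : 0 < x) : HasDerivAt E (F x / x) x := hw1.hasDerivAt hν hx.ne'
  have hopen : IsOpen (deltaInterval ν k) := isOpen_Ioo
  have hlog (x : ℝ) (hx : x ∈ deltaInterval ν k) :
      HasDerivAt (fun x => Real.log (diniEntire ν x)) (E x / (x * diniEntire ν x)) x := by
    obtain ⟨hx0, hpos⟩ := diniEntire_pos hν hx
    refine ((hd0 hx0).log hpos.ne').congr_deriv ?_
    rw [div_div]
  have hlog2 (x : ℝ) (hx : x ∈ deltaInterval ν k) :
      HasDerivAt (deriv fun x => Real.log (diniEntire ν x))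
        ((diniEntire ν x * (F x - E x) - E x ^ 2) / (x * diniEntire ν x) ^ 2) x := by
    obtain ⟨hx0, hpos⟩ := diniEntire_pos hν hx
    refine HasDerivAt.congr_deriv (((hd1 hx0).div ((hasDerivAt_id x).mul (hd0 hx0))
      (mul_pos hx0 hpos).ne').congr_of_eventuallyEq
      (by filter_upwards [hopen.mem_nhds hx] with y hy using (hlog y hy).deriv)) ?_
    simp only [Pi.mul_apply, id]
    field_simp
    ring
  refine concaveOn_of_deriv2_nonpos' (convex_Ioo _ _)
    (fun x hx => (hlog x hx).differentiableAt.differentiableWithinAt)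
    (fun x hx => (hlog2 x hx).differentiableAt.differentiableWithinAt) fun x hx => ?_
  rw [Function.iterate_succ_apply, Function.iterate_one, (hlog2 x hx).deriv]
  refine div_nonpos_of_nonpos_of_nonneg ?_ (sq_nonneg _)
  have hL := besselSeries_laguerre hν x
  have hFE : besselSeries ν (fun k => (2 * k - 1) * (2 * k * (2 * k + 1))) x = F x - E x := by
    have h := besselSeries_add hν (geomBounded_two_mul.mul hw1)
      ((geomBounded_affine 0 (-1)).mul hw1) x
    have h' := besselSeries_const_mul ν (-1) (fun k => 2 * (k : ℝ) * (2 * k + 1)) x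
    simp only [zero_mul, zero_add] at h
    rw [h'] at h
    rw [hF, hE, sub_eq_add_neg, ← neg_one_mul, ← h]
    congr 1
    ext k
    ring
  rw [hFE] at hL
  exact sub_nonpos.2 hL

/-! ### The inequality for functions with log-concave derivative -/

/-- A function with log-concave derivative grows at least as fast as predicted by the geometric
mean of the derivatives at the end points. -/
theorem mul_sqrt_le_sub_of_logConcave {s : Set ℝ} {f h : ℝ → ℝ}
    (hf : ∀ x ∈ s, HasDerivAt f (h x) x) (hpos : ∀ x ∈ s, 0 < h x)
    (hlog : ConcaveOn ℝ s fun x => Real.log (h x)) {a b : ℝ} (ha : a ∈ s) (hb : b ∈ s)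
    (hab : a ≤ b) : (b - a) * √(h a * h b) ≤ f b - f a := by
  have hsub : Set.Icc a b ⊆ s := by
    rw [← segment_eq_Icc hab]; exact hlog.1.segment_subset ha hb
  set m := (a + b) / 2 with hm
  set r := (b - a) / 2 with hr
  set c := √(h a * h b)
  have hr0 : 0 ≤ r := by rw [hr]; linarith
  have hmem {t : ℝ} (ht : t ∈ Set.Icc 0 r) : m + t ∈ Set.Icc a b ∧ m - t ∈ Set.Icc a b := by
    have h1 := ht.1
    have h2 := ht.2
    refine ⟨⟨?_, ?_⟩, ?_, ?_⟩ <;> linarith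
  -- Growing the interval symmetrically from the midpoint reduces the claim to h(m+t) + h(m-t) ≥ 2c.
  have hder (t : ℝ) (ht : t ∈ Set.Icc 0 r) :
      HasDerivAt (fun t => f (m + t) - f (m - t) - 2 * c * t) (h (m + t) + h (m - t) - 2 * c) t := by
    have h1 := (hf _ (hsub (hmem ht).1)).comp_const_add m t
    have h2 := (hf _ (hsub (hmem ht).2)).comp_const_sub m t
    refine ((h1.sub h2).sub ((hasDerivAt_id t).const_mul (2 * c))).congr_deriv ?_
    ring
  have hge (t : ℝ) (ht : t ∈ Set.Icc 0 r) : 0 ≤ h (m + t) + h (m - t) - 2 * c := by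
    have hp := hpos _ (hsub (hmem ht).1)
    have hq := hpos _ (hsub (hmem ht).2)
    have hA := hpos a ha
    have hB := hpos b hb
    have hprod : h a * h b ≤ h (m + t) * h (m - t) := by
      rw [← Real.log_le_log_iff (by positivity) (by positivity), Real.log_mul hA.ne' hB.ne',
        Real.log_mul hp.ne' hq.ne']
      -- The weights (1 ± t/r)/2 express m ± t through a and b and need r ≠ 0; the two concavity
      -- inequalities are then added.
      rcases hab.eq_or_lt with rfl | hlt
      · have ht0 : t = 0 := le_antisymm (by simpa [hr] using ht.2) ht.1
        simp [ht0, hm]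
      have hr1 : 0 < r := by rw [hr]; linarith
      have hθ0 : 0 ≤ (1 + t / r) / 2 := by have := div_nonneg ht.1 hr0; linarith
      have hθ1 : 0 ≤ (1 - t / r) / 2 := by
        have : t / r ≤ 1 := div_le_one_of_le₀ ht.2 hr0
        linarith
      have c1 := hlog.2 ha hb hθ1 hθ0 (by ring)
      have c2 := hlog.2 ha hb hθ0 hθ1 (by ring)
      have ea : a = m - r := by rw [hm, hr]; ring
      have eb : b = m + r := by rw [hm, hr]; ring
      have e1 : (1 - t / r) / 2 * a + (1 + t / r) / 2 * b = m + t := by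
        rw [ea, eb]; field_simp; ring
      have e2 : (1 + t / r) / 2 * a + (1 - t / r) / 2 * b = m - t := by
        rw [ea, eb]; field_simp; ring
      simp only [smul_eq_mul, e1, e2] at c1 c2
      linarith
    have hc : c ≤ (h (m + t) + h (m - t)) / 2 := by
      refine Real.sqrt_le_iff.2 ⟨by linarith, ?_⟩
      nlinarith [sq_nonneg (h (m + t) - h (m - t))]
    linarith
  have hmono : MonotoneOn (fun t => f (m + t) - f (m - t) - 2 * c * t) (Set.Icc 0 r) :=
    monotoneOn_of_hasDerivWithinAt_nonneg (convex_Icc _ _)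
      (fun t ht => (hder t ht).continuousAt.continuousWithinAt)
      (fun t ht => (hder t (interior_subset ht)).hasDerivWithinAt)
      fun t ht => hge t (interior_subset ht)
  have hfin := hmono (Set.left_mem_Icc.2 hr0) (Set.right_mem_Icc.2 hr0) hr0
  have e1 : m + r = b := by rw [hm, hr]; ring
  have e2 : m - r = a := by rw [hm, hr]; ring
  simp only [e1, e2, add_zero, sub_zero, sub_self, mul_zero] at hfin
  have : 2 * c * r = (b - a) * c := by rw [hr]; ring
  linarith

theorem abs_mul_sqrt_le_abs_sub_of_logConcave {s : Set ℝ} {f h : ℝ → ℝ}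
    (hf : ∀ x ∈ s, HasDerivAt f (h x) x) (hpos : ∀ x ∈ s, 0 < h x)
    (hlog : ConcaveOn ℝ s fun x => Real.log (h x)) {a b : ℝ} (ha : a ∈ s) (hb : b ∈ s) :
    |a - b| * √(h a * h b) ≤ |f a - f b| := by
  wlog hab : a ≤ b generalizing a b
  · rw [abs_sub_comm a, abs_sub_comm (f a), mul_comm (h a)]
    exact this hb ha (le_of_not_ge hab)
  rw [abs_sub_comm a, abs_of_nonneg (sub_nonneg.2 hab), abs_sub_comm (f a)]
  exact (mul_sqrt_le_sub_of_logConcave hf hpos hlog ha hb hab).trans (le_abs_self _)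

theorem theorem4 (ν : ℝ) (hν : -1 < ν) :
    (∀ x : ℝ, 0 < x →
      HasDerivAt (normBessel ν)
        ((2 : ℝ) ^ ν * Real.Gamma (ν + 1) * x ^ (-ν) * dini ν x) x) ∧
    (∀ k : ℕ, LogConcaveOn (deltaInterval ν k) (deriv (normBessel ν))) ∧
    (∀ k : ℕ, ∀ a ∈ deltaInterval ν k, ∀ b ∈ deltaInterval ν k,
      |a - b| * √(deriv (normBessel ν) a * deriv (normBessel ν) b)
        ≤ |normBessel ν a - normBessel ν b|) ∧
    (∀ k : ℕ, ∀ a ∈ deltaInterval ν k, ∀ b ∈ deltaInterval ν k,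
      |a - b| * √((a * b) ^ (-ν) * dini ν a * dini ν b)
        ≤ |a ^ (1 - ν) * besselJ ν a - b ^ (1 - ν) * besselJ ν b|) := by
  have hG : 0 < Real.Gamma (ν + 1) := Real.Gamma_pos_of_pos (by linarith)
  have h2 : (0 : ℝ) < 2 ^ ν := Real.rpow_pos_of_pos two_pos ν
  have hdini {x : ℝ} (hx : 0 < x) :
      (2 : ℝ) ^ ν * Real.Gamma (ν + 1) * x ^ (-ν) * dini ν x = diniEntire ν x := by
    have hxν := Real.rpow_pos_of_pos hx ν
    rw [dini_eq hν hx, Real.rpow_neg hx.le]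
    field_simp
  have hderiv {k : ℕ} {x : ℝ} (hx : x ∈ deltaInterval ν k) :
      deriv (normBessel ν) x = diniEntire ν x :=
    (hasDerivAt_normBessel hν (diniEntire_pos hν hx).1).deriv
  have hineq (k : ℕ) (a : ℝ) (ha : a ∈ deltaInterval ν k) (b : ℝ) (hb : b ∈ deltaInterval ν k) :
      |a - b| * √(diniEntire ν a * diniEntire ν b) ≤ |normBessel ν a - normBessel ν b| :=
    abs_mul_sqrt_le_abs_sub_of_logConcave
      (fun x hx => hasDerivAt_normBessel hν (diniEntire_pos hν hx).1)
      (fun x hx => (diniEntire_pos hν hx).2) (concaveOn_log_diniEntire hν k) ha hb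
  refine ⟨fun x hx => ?_, fun k => ⟨fun x hx => ?_, ?_⟩, fun k a ha b hb => ?_,
    fun k a ha b hb => ?_⟩
  · rw [hdini hx]
    exact hasDerivAt_normBessel hν hx
  · rw [hderiv hx]
    exact (diniEntire_pos hν hx).2
  · exact (concaveOn_log_diniEntire hν k).congr fun x hx => by simp only [hderiv hx]
  · rw [hderiv ha, hderiv hb]
    exact hineq k a ha b hb
  · have h := hineq k a ha b hb
    have ha0 := (diniEntire_pos hν ha).1
    have hb0 := (diniEntire_pos hν hb).1
    set K := (2 : ℝ) ^ ν * Real.Gamma (ν + 1) with hK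
    have hK0 : 0 < K := mul_pos h2 hG
    -- The constant K comes out of the square root once, matching its single power in the difference
    -- of g_ν, and cancels.
    have hsq : diniEntire ν a * diniEntire ν b =
        K ^ 2 * ((a * b) ^ (-ν) * dini ν a * dini ν b) := by
      rw [← hdini ha0, ← hdini hb0, Real.mul_rpow ha0.le hb0.le]
      ring
    have hnorm : normBessel ν a - normBessel ν b =
        K * (a ^ (1 - ν) * besselJ ν a - b ^ (1 - ν) * besselJ ν b) := by
      simp only [normBessel, ← hK]
      ring
    rw [hsq, Real.sqrt_mul (sq_nonneg K), Real.sqrt_sq hK0.le, hnorm, abs_mul, abs_of_pos hK0,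
      mul_left_comm] at h
    exact le_of_mul_le_mul_left h hK0
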